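/- Consider a metro loop line with $n$ segments, indexed cyclically by $j\in\mathbb Z/n\mathbb Z$. Let $b_j\in\{0,1\}$ be the number of trains on segment $j$ at time zero, $\bar b_j=1-b_j$, and let $m=\sum_j b_j$ be the number of trains. For each $j$ let $\tilde r_j,\underline g_j,\underline s_j\in\mathbb R$ (nominal run time and lower bounds), a demand parameter $0\le x_j<1$ and a control parameter $0\le\gamma_j\le 1$ be given, and put $X_j=\frac{x_j}{1-x_j}$ and $\delta_j=\frac{\gamma_jx_j}{1+\gamma_jx_j}$. The train dynamics for the departure times $d^k_j\in\mathbb R$ ($k\ge 0$) are, for all $k\ge1$ and all $j$, $$d^k_j=\max\Big\{(1-\delta_j)\,d^{k-b_j}_{j-1}+\delta_j\,d^{k-1}_j+(1-\delta_j)(\tilde r_j+X_j\underline g_j),\ \ d^{k-\bar b_{j+1}}_{j+1}+\underline s_{j+1}\Big\}.$$ Assume $0<m<n$. Then every initial vector $d^0\in\mathbb R^n$ determines exactly one solution $(d^k)_{k\ge0}$ of the dynamics, and there is a real number $h$ such that: (i) the dynamics admit a stationary regime with headway $h$: there is $v\in\mathbb R^n$ such that $d^k_j=v_j+kh$ is a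 solution; (ii) for every initial vector $d^0$, the solution has a unique asymptotic average growth vector $\lim_{k\to\infty}d^k/k$, and all its components equal $h$ (so it does not depend on $d^0$); (iii) $h$ is the asymptotic average train time-headway: for every solution, $\frac1{nK}\sum_{j}\sum_{k=1}^{K}(d^k_j-d^{k-1}_j)\to h$ as $K\to\infty$. -/

import Mathlib

open Filter Topology

/-- Data of a metro loop line with `n` segments, cyclically indexed by `ZMod n`. -/
structure MetroLine (n : ℕ) where
  /-- `b j` is the number of trains (`0` or `1`) on segment `j` at time zero. -/
  b : ZMod n → ℕ
  b_zero_or_one : ∀ j, b j = 0 ∨ b j = 1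
  /-- Passenger demand parameter. -/
  x : ZMod n → ℝ
  x_nonneg : ∀ j, 0 ≤ x j
  x_lt_one : ∀ j, x j < 1
  /-- Dwell time control parameter. -/
  γ : ZMod n → ℝ
  γ_nonneg : ∀ j, 0 ≤ γ j
  γ_le_one : ∀ j, γ j ≤ 1
  /-- Nominal run time. -/
  rNom : ZMod n → ℝ
  /-- Lower bound on the safe separation time. -/
  gMin : ZMod n → ℝ
  /-- Lower bound on `s = g - r`. -/
  sMin : ZMod n → ℝ

namespace MetroLine

variable {n : ℕ}

/-- The number `m` of running trains. -/
def numTrains [NeZero n] (L : MetroLine n) : ℕ := ∑ j, L.b j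

/-- `bbar j = 1 - b j` (no truncation occurs, since `b j` is `0` or `1`). -/
def bbar (L : MetroLine n) (j : ZMod n) : ℕ := 1 - L.b j

/-- `X_j = x_j / (1 - x_j)`. -/
noncomputable def X (L : MetroLine n) (j : ZMod n) : ℝ := L.x j / (1 - L.x j)

/-- `δ_j = γ_j x_j / (1 + γ_j x_j)`. -/
noncomputable def δ (L : MetroLine n) (j : ZMod n) : ℝ :=
  L.γ j * L.x j / (1 + L.γ j * L.x j)

/-- `d k j` (the `k`-th departure time on segment `j`) satisfies the train dynamics for all
`k ≥ 1`. All time indices on the right are `k` or `k - 1`, so natural subtraction is harmless. -/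
def IsTrajectory (L : MetroLine n) (d : ℕ → ZMod n → ℝ) : Prop :=
  ∀ k : ℕ, 1 ≤ k → ∀ j : ZMod n,
    d k j = max
      ((1 - L.δ j) * d (k - L.b j) (j - 1) + L.δ j * d (k - 1) j
        + (1 - L.δ j) * (L.rNom j + L.X j * L.gMin j))
      (d (k - L.bbar (j + 1)) (j + 1) + L.sMin (j + 1))

/-- A stationary regime: a solution of the dynamics in which all the headways equal `h`,
i.e. `d k j = v j + k h`. -/
def IsStationaryRegime (L : MetroLine n) (v : ZMod n → ℝ) (h : ℝ) : Prop :=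
  L.IsTrajectory (fun k j => v j + (k : ℝ) * h)

end MetroLine

/-- `χ` is the asymptotic average growth vector `lim d k / k` of the sequence `d`. -/
def HasGrowthVector {n : ℕ} (d : ℕ → ZMod n → ℝ) (χ : ZMod n → ℝ) : Prop :=
  ∀ j, Tendsto (fun k : ℕ => d k j / (k : ℝ)) atTop (𝓝 (χ j))

/-- The average, over all segments and over the first `K` departures, of the
time-headways `d k j - d (k - 1) j`. -/
noncomputable def avgHeadway {n : ℕ} [NeZero n] (d : ℕ → ZMod n → ℝ) (K : ℕ) : ℝ :=
  (∑ j, ∑ k ∈ Finset.Icc 1 K, (d k j - d (k - 1) j)) / ((n : ℝ) * (K : ℝ))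

/-!
The dynamics are implicit: `d k j` refers to `d k (j - 1)` when segment `j` is empty and to
`d k (j + 1)` when segment `j + 1` is occupied. As there is at least one train and at least one
empty segment, these same-time references never close up around the loop, so there is a rank on the
segments which decreases along them (`MetroLine.exists_rank`). Induction on the pair `(k, rank)`
yields both the solution (`MetroLine.solution`) and a comparison principle
(`MetroLine.IsTrajectory.le_add_of_zero_le_add`): an upper bound on the difference of two solutions
at time `0` persists. The latter gives uniqueness, and shows that every solution stays within
bounded distance of a stationary regime `v j + k h`, hence has growth rate `h`.

It remains to find a stationary regime. For `d k j = v j + k h` the term `δ j * d (k - 1) j` can be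
solved for, since `δ j / (1 - δ j) = γ j * x j`, and the dynamics become the max-plus linear system
`v j = max (v (j - 1) + f j) (v (j + 1) + g (j + 1))` with
`f j = rNom j + X j * gMin j - (b j + γ j * x j) * h` and `g j = sMin j - bbar j * h`. The simple
cycles of the underlying graph are the `n` two-cycles, of weight `f j + g j`, and the loop in its
two directions, of weights `∑ f` and `∑ g`. Each weight is affine and strictly decreasing in `h`, so
at the maximal cycle ratio `h` all of them are nonpositive and one vanishes. Then `v` is a vector
of heaviest path weights from a vertex of the critical cycle
(`exists_loop_potential`).
-/

/-! ### Functions on the cyclic index set -/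

lemma ZMod.sum_range_add_natCast_add_one {n : ℕ} [NeZero n] (f : ZMod n → ℝ) (i : ZMod n) :
    ∑ s ∈ Finset.range n, f (i + (s : ZMod n) + 1) = ∑ j, f j := by
  refine Finset.sum_bij' (fun s _ => i + (s : ZMod n) + 1) (fun j _ => (j - i - 1).val)
    (fun _ _ => Finset.mem_univ _)
    (fun j _ => Finset.mem_range.2 (ZMod.val_lt _)) ?_ ?_ (fun _ _ => rfl)
  · intro s hs
    have h : i + (s : ZMod n) + 1 - i - 1 = (s : ZMod n) := by ring
    rw [h, ZMod.val_natCast_of_lt (Finset.mem_range.1 hs)]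
  · intro j _
    rw [ZMod.natCast_zmod_val]
    ring

lemma ZMod.exists_eq_add_natCast {n : ℕ} [NeZero n] (i j : ZMod n) :
    ∃ t < n, j = i + (t : ZMod n) :=
  ⟨(j - i).val, ZMod.val_lt _, by rw [ZMod.natCast_zmod_val]; ring⟩

/-- A function on `{0, …, n}` with equal values at both ends descends to the cycle, starting at
any prescribed index `i`. -/
lemma ZMod.exists_forall_add_natCast_eq {n : ℕ} [NeZero n] (i : ZMod n) (V : ℕ → ℝ)
    (hV : V n = V 0) : ∃ v : ZMod n → ℝ, ∀ t ≤ n, v (i + (t : ZMod n)) = V t := by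
  refine ⟨fun j => V (j - i).val, fun t ht => ?_⟩
  rcases ht.lt_or_eq with h | rfl
  · simp [ZMod.val_natCast_of_lt h]
  · simp [hV]

/-! ### Max-plus potentials on a loop -/

/-- A max-plus linear system on the loop, with weight `f j` on the edge from `j - 1` to `j` and
`g j` on the edge from `j` to `j - 1`, is solvable when all simple cycles have nonpositive weight
and one of them has weight zero. -/
lemma exists_loop_potential {n : ℕ} [NeZero n] (f g : ZMod n → ℝ)
    (hfg : ∀ j, f j + g j ≤ 0) (hf : ∑ j, f j ≤ 0) (hg : ∑ j, g j ≤ 0)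
    (hcrit : ∑ j, f j = 0 ∨ ∑ j, g j = 0 ∨ ∃ j, f j + g j = 0) :
    ∃ v : ZMod n → ℝ, ∀ j, v (j - 1) + f j ≤ v j ∧ v (j + 1) + g (j + 1) ≤ v j ∧
      (v (j - 1) + f j = v j ∨ v (j + 1) + g (j + 1) = v j) := by
  -- `F i t` and `G i t` are the weights of the forward and the backward path from `i` to `i + t`.
  let F : ZMod n → ℕ → ℝ := fun i t => ∑ s ∈ Finset.range t, f (i + (s : ZMod n) + 1)
  let G : ZMod n → ℕ → ℝ := fun i t =>
    ∑ j, g j - ∑ s ∈ Finset.range t, g (i + (s : ZMod n) + 1)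
  have hF0 : ∀ i, F i 0 = 0 := fun i => by simp [F]
  have hFn : ∀ i, F i n = ∑ j, f j := fun i => ZMod.sum_range_add_natCast_add_one f i
  have hG0 : ∀ i, G i 0 = ∑ j, g j := fun i => by simp [G]
  have hGn : ∀ i, G i n = 0 := fun i => by simp [G, ZMod.sum_range_add_natCast_add_one g i]
  have hFs : ∀ i t, F i (t + 1) = F i t + f (i + (t : ZMod n) + 1) := fun i t => by
    simp [F, Finset.sum_range_succ]
  have hGs : ∀ i t, G i t = G i (t + 1) + g (i + (t : ZMod n) + 1) := fun i t => by
    simp only [G, Finset.sum_range_succ]; ring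
  -- A potential that is feasible along the path `i, i + 1, …, i + n` is feasible on the loop.
  have feasible : ∀ (i : ZMod n) (V : ℕ → ℝ) (v : ZMod n → ℝ),
      (∀ t ≤ n, v (i + (t : ZMod n)) = V t) →
      (∀ t < n, V t + f (i + (t : ZMod n) + 1) ≤ V (t + 1) ∧
        V (t + 1) + g (i + (t : ZMod n) + 1) ≤ V t) →
      ∀ j, v j + f (j + 1) ≤ v (j + 1) ∧ v (j + 1) + g (j + 1) ≤ v j := by
    intro i V v hv hV j
    obtain ⟨t, ht, rfl⟩ := ZMod.exists_eq_add_natCast i j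
    have h1 := hv t ht.le
    have h2 := hv (t + 1) ht
    rw [Nat.cast_succ, ← add_assoc] at h2
    rw [h1, h2]
    exact hV t ht
  suffices h : ∃ v : ZMod n → ℝ,
      (∀ j, v j + f (j + 1) ≤ v (j + 1) ∧ v (j + 1) + g (j + 1) ≤ v j) ∧
      ∀ j, v (j - 1) + f j = v j ∨ v (j + 1) + g (j + 1) = v j by
    obtain ⟨v, hv, hv'⟩ := h
    refine ⟨v, fun j => ⟨?_, (hv j).2, hv' j⟩⟩
    simpa using (hv (j - 1)).1
  rcases hcrit with h | h | ⟨i, hi⟩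
  · obtain ⟨v, hv⟩ := ZMod.exists_forall_add_natCast_eq (0 : ZMod n) (F 0) (by rw [hFn, hF0, h])
    refine ⟨v, feasible 0 _ v hv fun t _ => ?_, fun j => Or.inl ?_⟩
    · have := hFs 0 t
      have := hfg (0 + (t : ZMod n) + 1)
      constructor <;> linarith
    · obtain ⟨t, ht, hj⟩ := ZMod.exists_eq_add_natCast 0 (j - 1)
      obtain rfl : j = 0 + (t : ZMod n) + 1 := by rw [← hj]; ring
      have h2 := hv (t + 1) ht
      rw [Nat.cast_succ, ← add_assoc] at h2
      rw [hj, hv t ht.le, h2, hFs]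
  · obtain ⟨v, hv⟩ := ZMod.exists_forall_add_natCast_eq (0 : ZMod n) (G 0) (by rw [hGn, hG0, h])
    refine ⟨v, feasible 0 _ v hv fun t _ => ?_, fun j => Or.inr ?_⟩
    · have := hGs 0 t
      have := hfg (0 + (t : ZMod n) + 1)
      constructor <;> linarith
    · obtain ⟨t, ht, rfl⟩ := ZMod.exists_eq_add_natCast 0 j
      have h2 := hv (t + 1) ht
      rw [Nat.cast_succ, ← add_assoc] at h2
      rw [hv t ht.le, h2, ← hGs]
  · -- The heaviest path from `i` to `i + t` runs either forward or backward; both directions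
    -- return to `i` with nonpositive weight, so that the value at `i` is `0` at both ends.
    obtain ⟨v, hv⟩ := ZMod.exists_forall_add_natCast_eq i (fun t => max (F i t) (G i t))
      (by rw [hFn, hF0, hGn, hG0, max_eq_right hf, max_eq_left hg])
    have hfeas := feasible i _ v hv fun t _ => by
      have h1 := hFs i t
      have h2 := hGs i t
      have h3 := hfg (i + (t : ZMod n) + 1)
      constructor
      · rw [← max_add_add_right]
        exact max_le_max (by linarith) (by linarith)
      · rw [← max_add_add_right]
        exact max_le_max (by linarith) (by linarith)
    refine ⟨v, hfeas, fun j => ?_⟩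
    obtain ⟨t, ht, rfl⟩ := ZMod.exists_eq_add_natCast i j
    rcases Nat.eq_zero_or_pos t with rfl | htpos
    · -- At `i` the critical two-cycle through `i - 1` is attained.
      left
      have h1 := (hfeas (i - 1)).1
      have h2 := (hfeas (i - 1)).2
      rw [sub_add_cancel] at h1 h2
      simp only [Nat.cast_zero, add_zero]
      linarith
    · rcases le_total (G i t) (F i t) with hle | hle
      · left
        obtain ⟨u, rfl⟩ : ∃ u, t = u + 1 := ⟨t - 1, by omega⟩
        have h1 := (hfeas (i + (u : ZMod n))).1
        have h2 := hv (u + 1) ht.le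
        have h3 := hv u (by omega)
        have h4 := hFs i u
        have h5 := le_max_left (F i u) (G i u)
        simp only [max_eq_left hle] at h2
        rw [Nat.cast_succ, ← add_assoc] at h2 ⊢
        rw [add_sub_cancel_right]
        linarith
      · right
        have h1 := (hfeas (i + (t : ZMod n))).2
        have h2 := hv (t + 1) ht
        have h3 := hv t ht.le
        have h4 := hGs i t
        have h5 := le_max_right (F i (t + 1)) (G i (t + 1))
        simp only [max_eq_right hle] at h3
        rw [Nat.cast_succ, ← add_assoc] at h2
        linarith

/-- Finitely many affine functions of slope `-β`, `β > 0`, have a common point at which all are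
nonpositive and one vanishes. -/
lemma exists_maximal_ratio {ι : Type*} [Fintype ι] [Nonempty ι] (a β : ι → ℝ)
    (hβ : ∀ i, 0 < β i) : ∃ h : ℝ, (∀ i, a i - β i * h ≤ 0) ∧ ∃ i, a i - β i * h = 0 := by
  obtain ⟨i, hi⟩ := Finite.exists_max fun i => a i / β i
  refine ⟨a i / β i, fun k => ?_, i, ?_⟩
  · have := (div_le_iff₀ (hβ k)).1 (hi k)
    linarith
  · rw [mul_div_cancel₀ _ (hβ i).ne', sub_self]

namespace MetroLine

/-! ### Well-posedness of the dynamics -/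

lemma b_le_one (L : MetroLine n) (j : ZMod n) : L.b j ≤ 1 := by
  rcases L.b_zero_or_one j with h | h <;> omega

/-- The rank is the larger of the number of consecutive empty segments ending at `j` and the number
of consecutive occupied segments starting at `j + 1`. -/
lemma exists_rank [NeZero n] (L : MetroLine n) (hm : 0 < L.numTrains) (hmn : L.numTrains < n) :
    ∃ ρ : ZMod n → ℕ, (∀ j, L.b j = 0 → ρ (j - 1) < ρ j) ∧
      ∀ j, L.b j = 1 → ρ j < ρ (j - 1) := by
  obtain ⟨j₁, hj₁⟩ : ∃ j, L.b j = 1 := by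
    by_contra! hne
    have : L.numTrains = 0 :=
      Finset.sum_eq_zero fun j _ => (L.b_zero_or_one j).resolve_right (hne j)
    omega
  obtain ⟨j₀, hj₀⟩ : ∃ j, L.b j = 0 := by
    by_contra! hne
    have : L.numTrains = n := by
      simp [numTrains, fun j => (L.b_zero_or_one j).resolve_left (hne j), ZMod.card]
    omega
  have hz : ∀ j : ZMod n, ∃ i : ℕ, L.b (j - (i : ZMod n)) = 1 := fun j =>
    ⟨(j - j₁).val, by rw [ZMod.natCast_zmod_val, sub_sub_cancel, hj₁]⟩
  have ho : ∀ j : ZMod n, ∃ i : ℕ, L.b (j + 1 + (i : ZMod n)) = 0 := fun j =>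
    ⟨(j₀ - (j + 1)).val, by rw [ZMod.natCast_zmod_val, add_sub_cancel, hj₀]⟩
  refine ⟨fun j => max (Nat.find (hz j)) (Nat.find (ho j)), fun j hj => ?_, fun j hj => ?_⟩
  · have h1 : Nat.find (ho (j - 1)) = 0 := (Nat.find_eq_zero _).2 (by simp [hj])
    have h2 : Nat.find (hz j) ≠ 0 := fun h => by
      have := (Nat.find_eq_zero _).1 h
      simp [hj] at this
    obtain ⟨u, hu⟩ := Nat.exists_eq_succ_of_ne_zero h2
    have h3 := Nat.find_spec (hz j)
    rw [hu, Nat.cast_succ, add_comm, ← sub_sub] at h3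
    have h4 := Nat.find_min' (hz (j - 1)) h3
    have h5 := le_max_left (Nat.find (hz j)) (Nat.find (ho j))
    simp only [h1, max_lt_iff]
    omega
  · have h1 : Nat.find (hz j) = 0 := (Nat.find_eq_zero _).2 (by simp [hj])
    have h2 : Nat.find (ho (j - 1)) ≠ 0 := fun h => by
      have := (Nat.find_eq_zero _).1 h
      simp [hj] at this
    obtain ⟨u, hu⟩ := Nat.exists_eq_succ_of_ne_zero h2
    have h3 := Nat.find_spec (ho (j - 1))
    rw [hu, Nat.cast_succ, sub_add_cancel, add_comm (u : ZMod n), ← add_assoc] at h3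
    have h4 := Nat.find_min' (ho j) h3
    have h5 := le_max_right (Nat.find (hz (j - 1))) (Nat.find (ho (j - 1)))
    simp only [h1, max_lt_iff]
    omega

lemma lex_backward (L : MetroLine n) {ρ : ZMod n → ℕ} (h₀ : ∀ j, L.b j = 0 → ρ (j - 1) < ρ j)
    (k : ℕ) (j : ZMod n) :
    Prod.Lex (· < ·) (· < ·) (k + 1 - L.b j, ρ (j - 1)) (k + 1, ρ j) := by
  rcases L.b_zero_or_one j with h | h
  · rw [h]
    exact Prod.Lex.right _ (h₀ j h)
  · rw [h]
    exact Prod.Lex.left _ _ (by omega)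

lemma lex_forward (L : MetroLine n) {ρ : ZMod n → ℕ} (h₁ : ∀ j, L.b j = 1 → ρ j < ρ (j - 1))
    (k : ℕ) (j : ZMod n) :
    Prod.Lex (· < ·) (· < ·) (k + 1 - L.bbar (j + 1), ρ (j + 1)) (k + 1, ρ j) := by
  rcases L.b_zero_or_one (j + 1) with h | h
  · rw [bbar, h]
    exact Prod.Lex.left _ _ (by omega)
  · rw [bbar, h]
    have := h₁ (j + 1) h
    rw [add_sub_cancel_right] at this
    exact Prod.Lex.right _ this

/-- The solution of the dynamics with initial vector `d₀`, by recursion on the time and on a rank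
`ρ` decreasing along same-time references. -/
noncomputable def solution (L : MetroLine n) (ρ : ZMod n → ℕ)
    (h₀ : ∀ j, L.b j = 0 → ρ (j - 1) < ρ j) (h₁ : ∀ j, L.b j = 1 → ρ j < ρ (j - 1))
    (d₀ : ZMod n → ℝ) : ℕ → ZMod n → ℝ
  | 0, j => d₀ j
  | k + 1, j => max
      ((1 - L.δ j) * solution L ρ h₀ h₁ d₀ (k + 1 - L.b j) (j - 1)
        + L.δ j * solution L ρ h₀ h₁ d₀ k j
        + (1 - L.δ j) * (L.rNom j + L.X j * L.gMin j))
      (solution L ρ h₀ h₁ d₀ (k + 1 - L.bbar (j + 1)) (j + 1) + L.sMin (j + 1))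
  termination_by k j => (k, ρ j)
  decreasing_by
  · exact L.lex_backward h₀ k j
  · exact Prod.Lex.left _ _ k.lt_succ_self
  · exact L.lex_forward h₁ k j

lemma solution_isTrajectory (L : MetroLine n) (ρ : ZMod n → ℕ)
    (h₀ : ∀ j, L.b j = 0 → ρ (j - 1) < ρ j) (h₁ : ∀ j, L.b j = 1 → ρ j < ρ (j - 1))
    (d₀ : ZMod n → ℝ) : L.IsTrajectory (L.solution ρ h₀ h₁ d₀) := by
  intro k hk j
  obtain ⟨k, rfl⟩ := Nat.exists_eq_succ_of_ne_zero (Nat.one_le_iff_ne_zero.1 hk)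
  conv_lhs => rw [Nat.succ_eq_add_one, solution]
  simp

/-- Induction along the references made by the dynamics. -/
lemma dynamics_induction [NeZero n] (L : MetroLine n) (hm : 0 < L.numTrains)
    (hmn : L.numTrains < n) {P : ℕ → ZMod n → Prop} (zero : ∀ j, P 0 j)
    (succ : ∀ k j, P (k + 1 - L.b j) (j - 1) → P k j → P (k + 1 - L.bbar (j + 1)) (j + 1) →
      P (k + 1) j) (k : ℕ) (j : ZMod n) : P k j := by
  obtain ⟨ρ, h₀, h₁⟩ := L.exists_rank hm hmn
  have wf : WellFounded (Prod.Lex (· < · : ℕ → ℕ → Prop) (· < · : ℕ → ℕ → Prop)) :=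
    WellFounded.prod_lex Nat.lt_wfRel.wf Nat.lt_wfRel.wf
  suffices H : ∀ (p : ℕ × ℕ) k j, p = (k, ρ j) → P k j from H _ k j rfl
  intro p
  induction p using wf.induction with
  | _ p ih =>
    rintro k j rfl
    cases k with
    | zero => exact zero j
    | succ k =>
      exact succ k j (ih _ (L.lex_backward h₀ k j) _ _ rfl)
        (ih _ (Prod.Lex.left _ _ k.lt_succ_self) _ _ rfl)
        (ih _ (L.lex_forward h₁ k j) _ _ rfl)

lemma one_add_γ_mul_x_pos (L : MetroLine n) (j : ZMod n) : 0 < 1 + L.γ j * L.x j := by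
  have := mul_nonneg (L.γ_nonneg j) (L.x_nonneg j)
  linarith

lemma δ_nonneg (L : MetroLine n) (j : ZMod n) : 0 ≤ L.δ j :=
  div_nonneg (mul_nonneg (L.γ_nonneg j) (L.x_nonneg j)) (L.one_add_γ_mul_x_pos j).le

lemma δ_lt_one (L : MetroLine n) (j : ZMod n) : L.δ j < 1 := by
  rw [δ, div_lt_one (L.one_add_γ_mul_x_pos j)]
  linarith

lemma one_sub_δ_mul (L : MetroLine n) (j : ZMod n) :
    (1 - L.δ j) * (L.γ j * L.x j) = L.δ j := by
  have := (L.one_add_γ_mul_x_pos j).ne'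
  rw [δ]
  field_simp
  ring

/-- Comparison principle: the dynamics are monotone and commute with the addition of constants. -/
lemma IsTrajectory.le_add_of_zero_le_add [NeZero n] {L : MetroLine n} (hm : 0 < L.numTrains)
    (hmn : L.numTrains < n) {d e : ℕ → ZMod n → ℝ} (hd : L.IsTrajectory d)
    (he : L.IsTrajectory e) {c : ℝ} (h : ∀ j, d 0 j ≤ e 0 j + c) (k : ℕ) (j : ZMod n) :
    d k j ≤ e k j + c := by
  refine L.dynamics_induction hm hmn (P := fun k j => d k j ≤ e k j + c) h ?_ k j
  intro k j h1 h2 h3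
  rw [hd (k + 1) (by omega) j, he (k + 1) (by omega) j, ← max_add_add_right,
    Nat.add_sub_cancel]
  refine max_le_max ?_ (by linarith)
  have h4 := mul_le_mul_of_nonneg_left h1 (sub_nonneg.2 (L.δ_lt_one j).le)
  have h5 := mul_le_mul_of_nonneg_left h2 (L.δ_nonneg j)
  linarith

lemma existsUnique_isTrajectory [NeZero n] (L : MetroLine n) (hm : 0 < L.numTrains)
    (hmn : L.numTrains < n) (d₀ : ZMod n → ℝ) :
    ∃! d : ℕ → ZMod n → ℝ, L.IsTrajectory d ∧ d 0 = d₀ := by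
  obtain ⟨ρ, h₀, h₁⟩ := L.exists_rank hm hmn
  refine existsUnique_of_exists_of_unique
    ⟨_, L.solution_isTrajectory ρ h₀ h₁ d₀, funext fun j => by rw [solution]⟩ ?_
  rintro d e ⟨hd, hd0⟩ ⟨he, he0⟩
  funext k j
  apply le_antisymm
  · simpa using hd.le_add_of_zero_le_add hm hmn he (c := 0) (by simp [hd0, he0]) k j
  · simpa using he.le_add_of_zero_le_add hm hmn hd (c := 0) (by simp [hd0, he0]) k j

/-! ### Existence of a stationary regime -/

lemma cast_sub_b (L : MetroLine n) {k : ℕ} (hk : 1 ≤ k) (j : ZMod n) :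
    ((k - L.b j : ℕ) : ℝ) = k - L.b j :=
  Nat.cast_sub ((L.b_le_one j).trans hk)

lemma cast_bbar (L : MetroLine n) (j : ZMod n) : (L.bbar j : ℝ) = 1 - L.b j := by
  rw [bbar, Nat.cast_sub (L.b_le_one j), Nat.cast_one]

lemma cast_sub_bbar (L : MetroLine n) {k : ℕ} (hk : 1 ≤ k) (j : ZMod n) :
    ((k - L.bbar j : ℕ) : ℝ) = k - L.bbar j :=
  Nat.cast_sub ((Nat.sub_le 1 (L.b j)).trans hk)

/-- Solving for the implicit term `δ j * d (k - 1) j` reduces the stationarity of `v j + k h` to a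
max-plus linear system. -/
lemma isStationaryRegime_of_potential (L : MetroLine n) {v : ZMod n → ℝ} {h : ℝ}
    (hv : ∀ j,
      v (j - 1) + (L.rNom j + L.X j * L.gMin j - (L.b j + L.γ j * L.x j) * h) ≤ v j ∧
      v (j + 1) + (L.sMin (j + 1) - L.bbar (j + 1) * h) ≤ v j ∧
      (v (j - 1) + (L.rNom j + L.X j * L.gMin j - (L.b j + L.γ j * L.x j) * h) = v j ∨
        v (j + 1) + (L.sMin (j + 1) - L.bbar (j + 1) * h) = v j)) :
    L.IsStationaryRegime v h := by
  intro k hk j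
  obtain ⟨h1, h2, h3⟩ := hv j
  simp only [L.cast_sub_b hk, L.cast_sub_bbar hk, Nat.cast_sub hk, Nat.cast_one]
  have key : (1 - L.δ j) * (v (j - 1) + (k - L.b j) * h) + L.δ j * (v j + (k - 1) * h)
      + (1 - L.δ j) * (L.rNom j + L.X j * L.gMin j) =
      v j + k * h + (1 - L.δ j) * (v (j - 1) + (L.rNom j + L.X j * L.gMin j
        - (L.b j + L.γ j * L.x j) * h) - v j) := by
    linear_combination h * L.one_sub_δ_mul j
  rw [key]
  refine le_antisymm ?_ (max_le ?_ ?_)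
  · rcases h3 with h3 | h3
    · refine le_max_of_le_left ?_
      rw [h3]
      simp
    · refine le_max_of_le_right ?_
      linarith
  · have := mul_nonpos_of_nonneg_of_nonpos (sub_nonneg.2 (L.δ_lt_one j).le) (sub_nonpos.2 h1)
    linarith
  · linarith

lemma exists_isStationaryRegime [NeZero n] (L : MetroLine n) (hm : 0 < L.numTrains)
    (hmn : L.numTrains < n) : ∃ (h : ℝ) (v : ZMod n → ℝ), L.IsStationaryRegime v h := by
  have hγx : ∀ j, 0 ≤ L.γ j * L.x j := fun j => mul_nonneg (L.γ_nonneg j) (L.x_nonneg j)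
  have hb : ∑ j, (L.b j : ℝ) = L.numTrains := by simp [numTrains]
  have hbbar : ∑ j, (L.bbar j : ℝ) = n - L.numTrains := by
    simp [cast_bbar, hb, Finset.sum_sub_distrib, ZMod.card]
  have hp : 0 < ∑ j, ((L.b j : ℝ) + L.γ j * L.x j) := by
    have h1 : (0 : ℝ) < L.numTrains := by exact_mod_cast hm
    have h2 := Finset.sum_nonneg fun j (_ : j ∈ Finset.univ) => hγx j
    rw [Finset.sum_add_distrib, hb]
    linarith
  have hq : 0 < ∑ j, (L.bbar j : ℝ) := by
    have h1 : (L.numTrains : ℝ) < n := by exact_mod_cast hmn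
    rw [hbbar]
    linarith
  -- The simple cycles: the loop forward (`none`), the loop backward (`some none`) and the
  -- two-cycles (`some (some j)`).
  obtain ⟨h, hle, hcrit⟩ := exists_maximal_ratio
    (fun o : Option (Option (ZMod n)) => o.elim (∑ j, (L.rNom j + L.X j * L.gMin j)) fun o =>
      o.elim (∑ j, L.sMin j) fun j => L.rNom j + L.X j * L.gMin j + L.sMin j)
    (fun o => o.elim (∑ j, ((L.b j : ℝ) + L.γ j * L.x j)) fun o =>
      o.elim (∑ j, (L.bbar j : ℝ)) fun j => L.b j + L.γ j * L.x j + L.bbar j)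
    (by
      rintro (_ | _ | j)
      · exact hp
      · exact hq
      · have := hγx j
        simp only [Option.elim, cast_bbar]
        linarith)
  have hf : ∑ j, (L.rNom j + L.X j * L.gMin j - ((L.b j : ℝ) + L.γ j * L.x j) * h) =
      ∑ j, (L.rNom j + L.X j * L.gMin j) - (∑ j, ((L.b j : ℝ) + L.γ j * L.x j)) * h := by
    rw [Finset.sum_sub_distrib, Finset.sum_mul]
  have hg : ∑ j, (L.sMin j - (L.bbar j : ℝ) * h) =
      ∑ j, L.sMin j - (∑ j, (L.bbar j : ℝ)) * h := by
    rw [Finset.sum_sub_distrib, Finset.sum_mul]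
  obtain ⟨v, hv⟩ := exists_loop_potential
    (fun j => L.rNom j + L.X j * L.gMin j - ((L.b j : ℝ) + L.γ j * L.x j) * h)
    (fun j => L.sMin j - (L.bbar j : ℝ) * h)
    (fun j => by
      have := hle (some (some j))
      simp only [Option.elim] at this
      linarith)
    (hf.trans_le (hle none)) (hg.trans_le (hle (some none)))
    (by
      obtain ⟨_ | _ | j, ho⟩ := hcrit
      · exact Or.inl (hf.trans ho)
      · exact Or.inr (Or.inl (hg.trans ho))
      · simp only [Option.elim] at ho
        exact Or.inr (Or.inr ⟨j, by linarith⟩))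
  exact ⟨h, v, L.isStationaryRegime_of_potential hv⟩

end MetroLine

/-! ### Growth rate and average headway -/

lemma hasGrowthVector_of_bounded {n : ℕ} {d : ℕ → ZMod n → ℝ} {v : ZMod n → ℝ} {h c : ℝ}
    (hd : ∀ k j, |d k j - (v j + (k : ℝ) * h)| ≤ c) : HasGrowthVector d fun _ => h := by
  intro j
  have hlim : Tendsto (fun k : ℕ => (|v j| + c) / (k : ℝ)) atTop (𝓝 0) :=
    tendsto_const_nhds.div_atTop tendsto_natCast_atTop_atTop
  rw [tendsto_iff_dist_tendsto_zero]
  refine squeeze_zero' (Eventually.of_forall fun _ => dist_nonneg) ?_ hlim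
  filter_upwards [eventually_gt_atTop 0] with k hk
  have hk' : (0 : ℝ) < k := by exact_mod_cast hk
  have h1 : d k j / k - h = (d k j - (v j + k * h) + v j) / k := by
    field_simp
    ring
  rw [Real.dist_eq, h1, abs_div, abs_of_pos hk']
  gcongr
  have := abs_add_le (d k j - (v j + k * h)) (v j)
  have := hd k j
  linarith

lemma avgHeadway_eq {n : ℕ} [NeZero n] (d : ℕ → ZMod n → ℝ) (K : ℕ) :
    avgHeadway d K = (∑ j, (d K j / (K : ℝ) - d 0 j / (K : ℝ))) / (n : ℝ) := by
  have h : ∀ j, ∑ k ∈ Finset.Icc 1 K, (d k j - d (k - 1) j) = d K j - d 0 j := by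
    intro j
    induction K with
    | zero => simp
    | succ K ih => rw [Finset.sum_Icc_succ_top (by omega), ih, Nat.add_sub_cancel]; ring
  simp only [avgHeadway, h, ← sub_div, ← Finset.sum_div]
  rw [div_div, mul_comm]

lemma HasGrowthVector.tendsto_avgHeadway {n : ℕ} [NeZero n] {d : ℕ → ZMod n → ℝ} {h : ℝ}
    (hd : HasGrowthVector d fun _ => h) : Tendsto (avgHeadway d) atTop (𝓝 h) := by
  have h0 : ∀ j, Tendsto (fun K : ℕ => d 0 j / (K : ℝ)) atTop (𝓝 0) := fun j =>
    tendsto_const_nhds.div_atTop tendsto_natCast_atTop_atTop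
  have h1 := (tendsto_finsetSum Finset.univ fun j _ => (hd j).sub (h0 j)).div_const (n : ℝ)
  have hn : (n : ℝ) ≠ 0 := NeZero.ne _
  have h2 : (∑ _j : ZMod n, (h - 0)) / (n : ℝ) = h := by
    simp [ZMod.card, mul_div_cancel_left₀ _ hn]
  rw [h2] at h1
  exact h1.congr fun K => (avgHeadway_eq d K).symm

theorem theorem1 {n : ℕ} [NeZero n] (L : MetroLine n)
    (hm : 0 < L.numTrains) (hmn : L.numTrains < n) :
    (∀ d₀ : ZMod n → ℝ, ∃! d : ℕ → ZMod n → ℝ, L.IsTrajectory d ∧ d 0 = d₀) ∧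
    ∃ h : ℝ,
      (∃ v : ZMod n → ℝ, L.IsStationaryRegime v h) ∧
      ∀ d : ℕ → ZMod n → ℝ, L.IsTrajectory d →
        (∀ χ : ZMod n → ℝ, HasGrowthVector d χ ↔ χ = fun _ => h) ∧
        Tendsto (avgHeadway d) atTop (𝓝 h) := by
  refine ⟨L.existsUnique_isTrajectory hm hmn, ?_⟩
  obtain ⟨h, v, hv⟩ := L.exists_isStationaryRegime hm hmn
  refine ⟨h, ⟨v, hv⟩, fun d hd => ?_⟩
  obtain ⟨i, hi⟩ := Finite.exists_max fun j => |d 0 j - v j|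
  have hgrowth : HasGrowthVector d fun _ => h := by
    refine hasGrowthVector_of_bounded (v := v) (c := |d 0 i - v i|) fun k j => abs_le.2 ?_
    have h1 := hd.le_add_of_zero_le_add hm hmn hv (c := |d 0 i - v i|)
      (fun j => by
        have := (abs_le.1 (hi j)).2
        simp only [Nat.cast_zero, zero_mul]
        linarith) k j
    have h2 := hv.le_add_of_zero_le_add hm hmn hd (c := |d 0 i - v i|)
      (fun j => by
        have := (abs_le.1 (hi j)).1
        simp only [Nat.cast_zero, zero_mul]
        linarith) k j
    constructor <;> linarith
  refine ⟨fun χ => ⟨fun hχ => ?_, fun hχ => hχ ▸ hgrowth⟩, hgrowth.tendsto_avgHeadway⟩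
  funext j
  exact tendsto_nhds_unique (hχ j) (hgrowth j)
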